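/- Let $\ell^1(\mathbb{Z}_+)$ be equipped with the norm $\|q\|=\sum_{k\ge 0}|q_k|$, and regard the set $\mathcal{P}(\mathbb{Z}_+)$ of probability laws on $\mathbb{Z}_+=\{0,1,2,\dots\}$ as a subset of $\ell^1(\mathbb{Z}_+)$. Let $q\in\mathcal{P}(\mathbb{Z}_+)$ have finite mean $\lambda:=\sum_{k\ge 1}kq_k<\infty$, and let $\mathfrak{q}\colon[0,\infty)\to\ell^1(\mathbb{Z}_+)$ be the fluid limit started from $q$, i.e. the $\ell^1(\mathbb{Z}_+)$-valued solution of $$\frac{d\mathfrak{q}_k}{dt}=\mathfrak{q}_{k+1}-\mathfrak{q}_k\mathbf{1}_{(k\ge 1)}-\Big(\sum_{\ell\ge 1}\mathfrak{q}_\ell\Big)\big(\mathfrak{q}_k-\mathfrak{q}_{k-1}\mathbf{1}_{(k\ge 1)}\big)\qquad(k\in\mathbb{Z}_+,\ t\ge 0)$$ with $\mathfrak{q}(0)=q$, the derivative being taken in $\ell^1(\mathbb{Z}_+)$. Then $\|\mathfrak{q}(t)-\mathcal{G}(\lambda)\|\to 0$ as $t\to\infty$, where $\mathcal{G}(\lambda)$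 is the geometric law with mean $\lambda$, namely $$\mathcal{G}_k(\lambda)=\frac{1}{1+\lambda}\left(\frac{\lambda}{1+\lambda}\right)^k\qquad(k\in\mathbb{Z}_+),$$ with the convention $0^0=1$ (so that $\mathcal{G}(0)=\delta_0$). -/

import Mathlib

open scoped NNReal ENNReal Topology

noncomputable section

/-- The Banach space of absolutely summable real sequences indexed by the non-negative integers,
with its norm `‖q‖ = ∑ k, |q k|`. -/
abbrev EllOne : Type := lp (fun _ : ℕ => ℝ) 1

/-- The probability laws on the non-negative integers, as a subset of `EllOne`. -/
def probLaws : Set EllOne := {q | (∀ k, 0 ≤ q k) ∧ HasSum (fun k => q k) 1}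

theorem memEllOne_iff_summable (f : ℕ → ℝ) : Memℓp f 1 ↔ Summable f := by
  rw [memℓp_gen_iff (by norm_num)]
  simpa using summable_abs_iff

theorem EllOne.summable (q : EllOne) : Summable (fun k => q k) :=
  (memEllOne_iff_summable _).1 (lp.memℓp q)

/-- The geometric law with mean `ρ`, as a sequence. -/
def geometricSeq (ρ : ℝ≥0) (k : ℕ) : ℝ := 1 / (1 + (ρ : ℝ)) * ((ρ : ℝ) / (1 + (ρ : ℝ))) ^ k

theorem geometricSeq_memℓp (ρ : ℝ≥0) : Memℓp (geometricSeq ρ) 1 := by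
  rw [memEllOne_iff_summable]
  have hρ : (0 : ℝ) ≤ ρ := ρ.2
  refine (summable_geometric_of_lt_one (by positivity) ?_).mul_left _
  rw [div_lt_one (by positivity)]
  linarith

/-- The geometric law with mean `ρ`, as an element of `EllOne`. -/
def geometricLaw (ρ : ℝ≥0) : EllOne := ⟨geometricSeq ρ, geometricSeq_memℓp ρ⟩

/-- The `k`-th coordinate of the right-hand side of the fluid equation. For `k = 0` the terms with
`q k` and `q (k - 1)` in which the indicator of `1 ≤ k` appears are absent. -/
def fluidDriftSeq (q : EllOne) (k : ℕ) : ℝ :=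
  q (k + 1) - (if 1 ≤ k then q k else 0)
    - (∑' l : ℕ, q (l + 1)) * (q k - (if 1 ≤ k then q (k - 1) else 0))

theorem fluidDriftSeq_memℓp (q : EllOne) : Memℓp (fluidDriftSeq q) 1 := by
  rw [memEllOne_iff_summable]
  have h := q.summable
  have h1 : Summable (fun k => q (k + 1)) := (summable_nat_add_iff 1).2 h
  have h2 : Summable (fun k : ℕ => if 1 ≤ k then q k else 0) := by
    rw [← summable_nat_add_iff 1]
    simpa using h1
  have h3 : Summable (fun k : ℕ => if 1 ≤ k then q (k - 1) else 0) := by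
    rw [← summable_nat_add_iff 1]
    simpa using h
  exact (h1.sub h2).sub ((h.sub h3).mul_left _)

/-- The nonlinear vector field of the fluid equation on `EllOne`. -/
def fluidDrift (q : EllOne) : EllOne := ⟨fluidDriftSeq q, fluidDriftSeq_memℓp q⟩

/-- `x` is a solution on `[0, ∞)`, with values in `EllOne`, of the fluid equation with initial
condition `q` (only the values of `x` on `[0, ∞)` matter). The derivative is taken in the norm of
`EllOne`; at time `0` it is the right derivative. -/
structure IsFluidLimit (q : EllOne) (x : ℝ → EllOne) : Prop where
  initial : x 0 = q
  deriv : ∀ t : ℝ, 0 ≤ t → HasDerivWithinAt x (fluidDrift (x t)) (Set.Ici 0) t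

end

/-! Write `S_k` for the tails, `u = S_1`, and `J_k = u q_k - q_{k+1}` for the fluxes. For a law, the
fluid equation reads `S_{k+1}' = J_k`, and the fluxes all vanish exactly at geometric laws, where
`S_k = u ^ k`. The flow preserves positivity, total mass and mean (`mem_probLaws`,
`hasSum_upperTail_mean`).

Two Lyapunov functionals give convergence. First, for every `ρ` in `[0, 1]` the excess `E_ρ = ∑ (S_k
- ρ ^ k)⁺` decreases (`tailExcess_antitoneOn`): the tail dynamics is order-preserving and can be
compared with its equilibria. Second, the entropy `∑ q_k log q_k`, truncated, decreases at a rate at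
least `∑ J_k ^ 2` up to small boundary terms, so all fluxes tend to 0 along some sequence of times
(`exists_massFlux_small`).

Along a subsequence `S_k → u ^ k` for some limit `u`. Fatou gives `u / (1 - u) ≤ m`, with `m` the
mean. No mean escapes to infinity, because `E_ρ` never exceeds its initial value, which is small for
`ρ` near 1; hence equality and `u = m / (1 + m)`. For this ratio `E_u → 0` along the sequence, hence
for all `t → ∞` by monotonicity, and since the means agree, `4 E_u` bounds the distance in norm
(`norm_sub_geometricLaw_le`). -/

/-! ### Conservation of mass and positivity. -/

theorem EllOne.hasSum_abs (q : EllOne) : HasSum (fun k => |q k|) ‖q‖ := by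
  have h := lp.hasSum_norm (p := 1) (by norm_num) q
  simpa using h

/-- The total mass of a summable sequence, as a continuous linear functional. -/
noncomputable def EllOne.mass : EllOne →L[ℝ] ℝ :=
  LinearMap.mkContinuous
    { toFun := fun q => ∑' k, q k
      map_add' := fun p q => by simpa using p.summable.tsum_add q.summable
      map_smul' := fun c q => by simpa using q.summable.tsum_mul_left c } 1 fun q => by
    have h : ‖∑' k, q k‖ ≤ ∑' k, ‖q k‖ := norm_tsum_le_tsum_norm q.summable.norm
    simpa [q.hasSum_abs.tsum_eq] using h

theorem EllOne.hasSum_mass (q : EllOne) : HasSum (fun k => q k) (EllOne.mass q) :=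
  q.summable.hasSum

/-- The rate at which particles jump onto a given site. -/
noncomputable def arrivalRate (q : EllOne) : ℝ := ∑' l : ℕ, q (l + 1)

theorem hasSum_succ (q : EllOne) : HasSum (fun l => q (l + 1)) (arrivalRate q) :=
  ((summable_nat_add_iff 1).2 q.summable).hasSum

theorem mass_eq_add_arrivalRate (q : EllOne) : EllOne.mass q = q 0 + arrivalRate q :=
  q.summable.tsum_eq_zero_add

theorem fluidDrift_apply (q : EllOne) (k : ℕ) :
    fluidDrift q k = q (k + 1) - (if 1 ≤ k then q k else 0)
      - arrivalRate q * (q k - (if 1 ≤ k then q (k - 1) else 0)) := rfl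

theorem hasSum_restrict_pos {f : ℕ → ℝ} {a : ℝ} (h : HasSum (fun k => f (k + 1)) a) :
    HasSum (fun k => if 1 ≤ k then f k else 0) a := by
  rw [← hasSum_nat_add_iff' 1]
  simpa using h

theorem hasSum_shift {f : ℕ → ℝ} {a : ℝ} (h : HasSum f a) :
    HasSum (fun k => if 1 ≤ k then f (k - 1) else 0) a := by
  rw [← hasSum_nat_add_iff' 1]
  simpa using h

theorem mass_fluidDrift (q : EllOne) : EllOne.mass (fluidDrift q) = 0 := by
  have h1 := hasSum_succ q
  have h := (h1.sub (hasSum_restrict_pos h1)).sub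
    ((q.hasSum_mass.sub (hasSum_shift q.hasSum_mass)).mul_left (arrivalRate q))
  refine (HasSum.unique (EllOne.hasSum_mass _) ?_)
  simpa [fluidDrift_apply] using h

theorem abs_euler_step_le {h a b : ℝ} (h0 : 0 ≤ h) (ha : 0 ≤ a) (hb : 0 ≤ b) (v w z : ℝ) {c : ℝ}
    (hc : 0 ≤ 1 - h * a - h * c) :
    |v + h * (w - c * v - (a - b) * (v - z))| ≤
      (1 - h * a) * |v| - h * (c * |v|) + h * |w| + h * a * |z| + h * b * (|v| + |z|) := by
  have e : v + h * (w - c * v - (a - b) * (v - z))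
      = ((1 - h * a - h * c) * v + h * w + h * a * z) + h * b * (v - z) := by ring
  have t1 := abs_add_le ((1 - h * a - h * c) * v + h * w + h * a * z) (h * b * (v - z))
  have t2 := abs_add_three ((1 - h * a - h * c) * v) (h * w) (h * a * z)
  have t3 : |h * b * (v - z)| ≤ h * b * (|v| + |z|) := by
    rw [abs_mul, abs_of_nonneg (mul_nonneg h0 hb)]
    exact mul_le_mul_of_nonneg_left (abs_sub _ _) (mul_nonneg h0 hb)
  rw [abs_mul, abs_mul h w, abs_mul (h * a) z, abs_of_nonneg hc, abs_of_nonneg h0,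
    abs_of_nonneg (mul_nonneg h0 ha)] at t2
  rw [e]
  linarith

/-- With a nonnegative arrival rate, a short Euler step is a stochastic kernel and does not increase
the norm. Only the negative part of the rate costs anything. -/
theorem norm_add_smul_fluidDrift_le (q : EllOne) {h : ℝ} (h0 : 0 ≤ h)
    (h1 : h * (1 + max (arrivalRate q) 0) ≤ 1) :
    ‖q + h • fluidDrift q‖ ≤ ‖q‖ + h * (2 * max (-arrivalRate q) 0 * ‖q‖) := by
  obtain ⟨a, ha⟩ : ∃ a, a = max (arrivalRate q) 0 := ⟨_, rfl⟩
  obtain ⟨b, hb⟩ : ∃ b, b = max (-arrivalRate q) 0 := ⟨_, rfl⟩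
  have hab : arrivalRate q = a - b := by
    rw [ha, hb]; rcases le_total (arrivalRate q) 0 with h | h <;> simp [h]
  have ha0 : 0 ≤ a := ha ▸ le_max_right _ _
  have hb0 : 0 ≤ b := hb ▸ le_max_right _ _
  rw [← ha] at h1
  rw [← hb]
  have hs := q.hasSum_abs
  have hs1 : HasSum (fun k => |q (k + 1)|) (‖q‖ - |q 0|) := by
    have := (hasSum_nat_add_iff' (f := fun k => |q k|) 1).2 hs
    simpa using this
  have hr := hasSum_restrict_pos (f := fun k => |q k|) hs1
  have hsh := hasSum_shift hs
  have hR := ((((hs.mul_left (1 - h * a)).sub (hr.mul_left h)).add (hs1.mul_left h)).add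
    (hsh.mul_left (h * a))).add ((hs.add hsh).mul_left (h * b))
  have hL := (q + h • fluidDrift q).hasSum_abs
  refine (hasSum_le (fun k => ?_) hL hR).trans (le_of_eq (by ring))
  have e1 : (q + h • fluidDrift q) k = q k + h * fluidDrift q k := rfl
  rw [e1, fluidDrift_apply, hab]
  rcases k with _ | k
  · have := abs_euler_step_le h0 ha0 hb0 (q 0) (q 1) 0 (c := 0) (by nlinarith)
    simpa using this
  · have := abs_euler_step_le h0 ha0 hb0 (q (k + 1)) (q (k + 1 + 1)) (q k) (c := 1) (by linarith)
    simpa using this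

/-- A bound on explicit Euler steps bounds the upper right Dini derivative of a Lipschitz
functional along a differentiable curve. -/
theorem eventually_slope_lt_of_euler_step {F : Type*} [NormedAddCommGroup F] [NormedSpace ℝ F]
    {N : F → ℝ} {C : ℝ} (hN : ∀ p q, N p - N q ≤ C * ‖p - q‖) {y : ℝ → F} {v : F} {t c : ℝ}
    (hy : HasDerivWithinAt y v (Set.Ici t) t)
    (hstep : ∀ᶠ h in 𝓝[>] (0 : ℝ), N (y t + h • v) ≤ N (y t) + h * c) {r : ℝ} (hr : c < r) :
    ∀ᶠ z in 𝓝[>] t, (z - t)⁻¹ * (N (y z) - N (y t)) < r := by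
  have hC : ∃ δ > 0, C * δ < r - c := by
    refine ⟨(r - c) / (2 * (|C| + 1)), by have := sub_pos.2 hr; positivity, ?_⟩
    have h1 : C * ((r - c) / (2 * (|C| + 1))) ≤ (|C| + 1) * ((r - c) / (2 * (|C| + 1))) := by
      have := sub_pos.2 hr
      gcongr
      linarith [le_abs_self C]
    have h2 : (|C| + 1) * ((r - c) / (2 * (|C| + 1))) = (r - c) / 2 := by
      have : |C| + 1 ≠ 0 := by positivity
      field_simp
    linarith
  obtain ⟨δ, hδ, hCδ⟩ := hC
  have ho := (hasDerivWithinAt_iff_isLittleO.1 hy).def hδ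
  have ho' := ho.filter_mono (nhdsWithin_mono t Set.Ioi_subset_Ici_self)
  have hm : Filter.Tendsto (fun z => z - t) (𝓝[>] t) (𝓝[>] 0) := by
    refine tendsto_nhdsWithin_iff.2 ⟨?_, ?_⟩
    · have : Filter.Tendsto (fun z => z - t) (𝓝 t) (𝓝 (t - t)) :=
        (continuous_id.sub continuous_const).tendsto t
      rw [sub_self] at this
      exact this.mono_left nhdsWithin_le_nhds
    · filter_upwards [self_mem_nhdsWithin] with z hz
      exact sub_pos.2 (Set.mem_Ioi.1 hz)
  filter_upwards [ho', hm.eventually hstep, self_mem_nhdsWithin] with z h1 h2 hz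
  have hz' : 0 < z - t := sub_pos.2 (Set.mem_Ioi.1 hz)
  rw [inv_mul_lt_iff₀ hz']
  have h3 := hN (y z) (y t + (z - t) • v)
  have h4 : y z - (y t + (z - t) • v) = y z - y t - (z - t) • v := by abel
  rw [h4] at h3
  rw [Real.norm_of_nonneg hz'.le] at h1
  have h5 : C * ‖y z - y t - (z - t) • v‖ ≤ |C| * (δ * (z - t)) :=
    mul_le_mul (le_abs_self C) h1 (norm_nonneg _) (abs_nonneg _)
  rcases le_or_gt 0 C with hC0 | hC0
  · rw [abs_of_nonneg hC0] at h5
    nlinarith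
  · have : C * ‖y z - y t - (z - t) • v‖ ≤ 0 := mul_nonpos_of_nonpos_of_nonneg hC0.le (norm_nonneg _)
    nlinarith

namespace IsFluidLimit

variable {q : EllOne} {x : ℝ → EllOne}

theorem continuousOn (hx : IsFluidLimit q x) : ContinuousOn x (Set.Ici 0) :=
  fun t ht => (hx.deriv t ht).continuousWithinAt

theorem hasDerivWithinAt_right (hx : IsFluidLimit q x) {t : ℝ} (ht : 0 ≤ t) :
    HasDerivWithinAt x (fluidDrift (x t)) (Set.Ici t) t :=
  (hx.deriv t ht).mono (Set.Ici_subset_Ici.2 ht)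

theorem mass_eq (hx : IsFluidLimit q x) {t : ℝ} (ht : 0 ≤ t) :
    EllOne.mass (x t) = EllOne.mass q := by
  rw [← hx.initial]
  refine constant_of_has_deriv_right_zero (f := fun t => EllOne.mass (x t)) (a := 0) (b := t)
    ?_ ?_ t ⟨ht, le_rfl⟩
  · exact EllOne.mass.continuous.comp_continuousOn
      (hx.continuousOn.mono Set.Icc_subset_Ici_self)
  · intro s hs
    have := EllOne.mass.hasFDerivAt.comp_hasDerivWithinAt s (hx.hasDerivWithinAt_right hs.1)
    rwa [mass_fluidDrift] at this

/-- Mass 1 forces norm at least 1. A negative arrival rate is controlled by the surplus `‖x‖ - 1`,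
so Gronwall keeps this surplus at its initial value 0. Equality of norm and mass then yields
positivity. -/
theorem norm_eq_one (hx : IsFluidLimit q x) (hq : q ∈ probLaws) {t : ℝ} (ht : 0 ≤ t) :
    ‖x t‖ = 1 := by
  have hmass : ∀ s, 0 ≤ s → EllOne.mass (x s) = 1 := fun s hs => by
    rw [hx.mass_eq hs]; exact hq.2.tsum_eq
  have hge : ∀ s, 0 ≤ s → 1 ≤ ‖x s‖ := fun s hs => by
    rw [← hmass s hs]
    exact hasSum_le (fun k => le_abs_self _) (EllOne.hasSum_mass _) (EllOne.hasSum_abs _)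
  have hneg : ∀ s, 0 ≤ s → max (-arrivalRate (x s)) 0 * 2 ≤ ‖x s‖ - 1 := fun s hs => by
    have h1 := (hasSum_nat_add_iff' 1).2 (x s).hasSum_abs
    have h2 := h1.add (hasSum_succ (x s))
    have h3 := h2.nonneg fun k => by linarith [neg_abs_le (x s (k + 1))]
    have h4 := mass_eq_add_arrivalRate (x s)
    rw [hmass s hs] at h4
    simp only [Finset.range_one, Finset.sum_singleton] at h3
    rcases le_total (arrivalRate (x s)) 0 with h | h
    · rw [max_eq_left (by linarith)]
      linarith [le_abs_self (x s 0)]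
    · rw [max_eq_right (by linarith)]
      linarith [hge s hs]
  have hcont : ContinuousOn (fun s => ‖x s‖) (Set.Icc 0 t) :=
    (hx.continuousOn.mono Set.Icc_subset_Ici_self).norm
  obtain ⟨C, hC⟩ := isCompact_Icc.bddAbove_image hcont
  have key := le_gronwallBound_of_liminf_deriv_right_le (f := fun s => ‖x s‖ - 1)
    (f' := fun s => 2 * max (-arrivalRate (x s)) 0 * ‖x s‖) (δ := 0) (K := C) (ε := 0)
    (a := 0) (b := t) (hcont.sub continuousOn_const) ?_ ?_ ?_ t ⟨ht, le_rfl⟩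
  · rw [gronwallBound_ε0_δ0] at key
    linarith [hge t ht]
  · intro s hs r hr
    refine (eventually_slope_lt_of_euler_step (N := fun p : EllOne => ‖p‖ - 1) (C := 1) ?_
      (hx.hasDerivWithinAt_right hs.1) ?_ hr).frequently
    · intro p q
      linarith [norm_sub_norm_le p q]
    · have hpos : 0 < (1 + max (arrivalRate (x s)) 0)⁻¹ := by positivity
      filter_upwards [Ioo_mem_nhdsGT hpos] with h hh
      have := norm_add_smul_fluidDrift_le (x s) hh.1.le (by
        have h1 : 0 < 1 + max (arrivalRate (x s)) 0 := by positivity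
        calc _ ≤ (1 + max (arrivalRate (x s)) 0)⁻¹ * (1 + max (arrivalRate (x s)) 0) := by
              gcongr; exact hh.2.le
          _ = 1 := inv_mul_cancel₀ h1.ne')
      linarith
  · rw [hx.initial]
    have : ‖q‖ = 1 := by
      refine q.hasSum_abs.unique ?_
      simpa [abs_of_nonneg (hq.1 _)] using hq.2
    simp [this]
  · intro s hs
    have h1 : ‖x s‖ ≤ C := hC ⟨s, ⟨hs.1, hs.2.le⟩, rfl⟩
    have h2 := hneg s hs.1
    have h3 := hge s hs.1
    have h4 : 0 ≤ max (-arrivalRate (x s)) 0 := le_max_right _ _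
    nlinarith

theorem mem_probLaws (hx : IsFluidLimit q x) (hq : q ∈ probLaws) {t : ℝ} (ht : 0 ≤ t) :
    x t ∈ probLaws := by
  have hm : EllOne.mass (x t) = 1 := by rw [hx.mass_eq ht]; exact hq.2.tsum_eq
  have hs := (x t).hasSum_mass
  rw [hm] at hs
  refine ⟨fun k => ?_, hs⟩
  have ha := (x t).hasSum_abs
  rw [hx.norm_eq_one hq ht] at ha
  have h0 := ha.sub hs
  rw [sub_self, hasSum_zero_iff_of_nonneg fun k => sub_nonneg.2 (le_abs_self _)] at h0
  have := congrFun h0 k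
  simp only [Pi.zero_apply] at this
  linarith [abs_nonneg (x t k)]

end IsFluidLimit

/-! ### Tails, fluxes and the tail excess of a law. -/

/-- The mass that a law `q` gives to `{k, k + 1, …}`. -/
noncomputable def upperTail (q : EllOne) (k : ℕ) : ℝ := 1 - ∑ j ∈ Finset.range k, q j

/-- The net flow of mass from `k` to `k + 1` under the fluid equation. -/
noncomputable def massFlux (q : EllOne) (k : ℕ) : ℝ := upperTail q 1 * q k - q (k + 1)

theorem upperTail_zero (q : EllOne) : upperTail q 0 = 1 := by simp [upperTail]

theorem upperTail_succ (q : EllOne) (k : ℕ) : upperTail q (k + 1) = upperTail q k - q k := by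
  simp [upperTail, Finset.sum_range_succ]; ring

section probLaws

variable {q : EllOne} (hq : q ∈ probLaws)
include hq

theorem hasSum_upperTail (k : ℕ) : HasSum (fun j => q (j + k)) (upperTail q k) :=
  (hasSum_nat_add_iff' (f := fun j => q j) k).2 hq.2

theorem upperTail_nonneg (k : ℕ) : 0 ≤ upperTail q k :=
  (hasSum_upperTail hq k).nonneg fun _ => hq.1 _

theorem upperTail_antitone : Antitone (upperTail q) :=
  antitone_nat_of_succ_le fun k => by rw [upperTail_succ]; linarith [hq.1 k]

theorem upperTail_le_one (k : ℕ) : upperTail q k ≤ 1 :=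
  (upperTail_antitone hq (Nat.zero_le k)).trans (upperTail_zero q).le

theorem le_upperTail (k : ℕ) : q k ≤ upperTail q k := by
  have := upperTail_succ q k
  linarith [upperTail_nonneg hq (k + 1)]

theorem arrivalRate_eq_upperTail : arrivalRate q = upperTail q 1 :=
  (hasSum_succ q).unique (hasSum_upperTail hq 1)

theorem fluidDrift_zero : fluidDrift q 0 = -massFlux q 0 := by
  rw [fluidDrift_apply, arrivalRate_eq_upperTail hq]; simp [massFlux]

theorem fluidDrift_succ (k : ℕ) : fluidDrift q (k + 1) = massFlux q k - massFlux q (k + 1) := by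
  rw [fluidDrift_apply, arrivalRate_eq_upperTail hq]; simp [massFlux]; ring

theorem sum_fluidDrift (k : ℕ) : ∑ j ∈ Finset.range (k + 1), fluidDrift q j = -massFlux q k := by
  induction k with
  | zero => simpa using fluidDrift_zero hq
  | succ k ih => rw [Finset.sum_range_succ, ih, fluidDrift_succ hq]; ring

theorem hasSum_upperTail_of_hasSum_mean {m : ℝ} (hm : HasSum (fun k : ℕ => (k : ℝ) * q k) m) :
    HasSum (fun k => upperTail q (k + 1)) m := by
  have key : ∀ K : ℕ, ∑ k ∈ Finset.range K, upperTail q (k + 1)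
      = ∑ k ∈ Finset.range (K + 1), (k : ℝ) * q k + K * upperTail q (K + 1) := by
    intro K
    induction K with
    | zero => simp
    | succ K ih =>
      rw [Finset.sum_range_succ, ih, Finset.sum_range_succ _ (K + 1), upperTail_succ q (K + 1)]
      push_cast
      ring
  have htail : Filter.Tendsto (fun K : ℕ => (K : ℝ) * upperTail q (K + 1)) Filter.atTop (𝓝 0) := by
    have h1 : Filter.Tendsto (fun K : ℕ => m - ∑ k ∈ Finset.range (K + 1), (k : ℝ) * q k)
        Filter.atTop (𝓝 0) := by
      have := ((Filter.tendsto_add_atTop_iff_nat 1).2 hm.tendsto_sum_nat).const_sub m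
      simpa using this
    refine squeeze_zero (fun K => mul_nonneg K.cast_nonneg (upperTail_nonneg hq _)) (fun K => ?_) h1
    refine hasSum_le (fun j => ?_) ((hasSum_upperTail hq (K + 1)).mul_left (K : ℝ))
      ((hasSum_nat_add_iff' (f := fun k : ℕ => (k : ℝ) * q k) (K + 1)).2 hm)
    refine mul_le_mul_of_nonneg_right ?_ (hq.1 _)
    push_cast
    linarith [(j.cast_nonneg : (0 : ℝ) ≤ j)]
  rw [hasSum_iff_tendsto_nat_of_nonneg fun k => upperTail_nonneg hq _]
  simp only [key]
  simpa using ((Filter.tendsto_add_atTop_iff_nat 1).2 hm.tendsto_sum_nat).add htail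

theorem mul_upperTail_le_sum (K : ℕ) :
    (K : ℝ) * upperTail q K ≤ ∑ k ∈ Finset.range K, upperTail q (k + 1) := by
  have := Finset.card_nsmul_le_sum (Finset.range K) (fun k => upperTail q (k + 1)) (upperTail q K)
    fun k hk => upperTail_antitone hq (Finset.mem_range.1 hk)
  simpa using this

theorem upperTail_le_div {m : ℝ} (hm : HasSum (fun k => upperTail q (k + 1)) m) {K : ℕ}
    (hK : 0 < K) : upperTail q K ≤ m / K := by
  rw [le_div_iff₀ (by exact_mod_cast hK), mul_comm]
  exact (mul_upperTail_le_sum hq K).trans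
    (sum_le_hasSum _ (fun k _ => upperTail_nonneg hq _) hm)

omit hq in
theorem sum_massFlux (q : EllOne) (K : ℕ) : ∑ k ∈ Finset.range K, massFlux q k
    = upperTail q (K + 1) - upperTail q 1 * upperTail q K := by
  induction K with
  | zero => simp [upperTail_zero]
  | succ K ih =>
    rw [Finset.sum_range_succ, ih, massFlux, upperTail_succ q (K + 1), upperTail_succ q K]; ring

/-- Sum of the positive parts of `upperTail q k - ρ ^ k` over `1 ≤ k ≤ K`. -/
noncomputable def partialTailExcess (ρ : ℝ) (K : ℕ) (q : EllOne) : ℝ :=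
  ∑ k ∈ Finset.range K, max (upperTail q (k + 1) - ρ ^ (k + 1)) 0

theorem upperTail_euler_step (h : ℝ) (k : ℕ) :
    upperTail (q + h • fluidDrift q) (k + 1) = upperTail q (k + 1) + h * massFlux q k := by
  have e : ∀ j, (q + h • fluidDrift q) j = q j + h * fluidDrift q j := fun _ => rfl
  simp only [upperTail, e, Finset.sum_add_distrib, ← Finset.mul_sum, sum_fluidDrift hq]
  ring

theorem partialTailExcess_euler_step_le {ρ : ℝ} (hρ0 : 0 ≤ ρ) (hρ1 : ρ ≤ 1) (K : ℕ) {h : ℝ}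
    (h0 : 0 ≤ h) (h1 : 2 * h ≤ 1) :
    partialTailExcess ρ K (q + h • fluidDrift q)
      ≤ partialTailExcess ρ K q + h * upperTail q (K + 1) := by
  set p : ℕ → ℝ := fun k => max (upperTail q k - ρ ^ k) 0 with hp
  have hp0 : ∀ k, 0 ≤ p k := fun k => le_max_right _ _
  have hpl : ∀ k, upperTail q k - ρ ^ k ≤ p k := fun k => le_max_left _ _
  have hu0 := upperTail_nonneg hq 1
  have hu1 := upperTail_le_one hq 1
  have hρk : ∀ k, 0 ≤ ρ ^ k := fun k => pow_nonneg hρ0 k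
  have hpz : p 0 = 0 := by simp [hp, upperTail_zero]
  -- Subtract the equilibrium equation for `ρ ^ k`. The nonlinearity contributes `(u - ρ) * (ρ ^ k -
  -- ρ ^ (k + 1))`, so the step is a combination of the differences `S_j - ρ ^ j` with nonnegative
  -- coefficients, and each may be replaced by its positive part.
  have hstep : ∀ k, max (upperTail (q + h • fluidDrift q) (k + 1) - ρ ^ (k + 1)) 0
      ≤ p (k + 1) - h * (1 + upperTail q 1) * p (k + 1) + h * upperTail q 1 * p k
        + h * (p 1 * (ρ ^ k - ρ ^ (k + 1))) + h * p (k + 2) := by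
    intro k
    have hg : 0 ≤ ρ ^ k - ρ ^ (k + 1) := by
      rw [pow_succ]; nlinarith [hρk k]
    have hc : 0 ≤ 1 - h * (1 + upperTail q 1) := by nlinarith
    have a1 := mul_le_mul_of_nonneg_left (hpl (k + 1)) hc
    have a2 := mul_le_mul_of_nonneg_left (hpl k) (mul_nonneg h0 hu0)
    have a3 := mul_le_mul_of_nonneg_left (mul_le_mul_of_nonneg_right (hpl 1) hg) h0
    have a4 := mul_le_mul_of_nonneg_left (hpl (k + 2)) h0
    refine max_le ?_ ?_
    · rw [upperTail_euler_step hq]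
      have e1 : q k = upperTail q k - upperTail q (k + 1) := by rw [upperTail_succ]; ring
      have e2 : q (k + 1) = upperTail q (k + 1) - upperTail q (k + 2) := by
        rw [upperTail_succ q (k + 1)]; ring
      rw [massFlux, e1, e2]
      have e3 : ρ ^ (k + 2) = ρ ^ k * ρ ^ 2 := pow_add _ _ _
      have e4 : ρ ^ (k + 1) = ρ ^ k * ρ := pow_succ _ _
      rw [e3] at a4
      rw [e4] at a1 a3 ⊢
      rw [pow_one] at a3
      linarith
    · have b1 := mul_nonneg hc (hp0 (k + 1))
      have b2 := mul_nonneg (mul_nonneg h0 hu0) (hp0 k)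
      have b3 := mul_nonneg h0 (mul_nonneg (hp0 1) hg)
      have b4 := mul_nonneg h0 (hp0 (k + 2))
      linarith
  -- Everything telescopes: the loss `p 1` at the lower end cancels the gain `p 1 * (1 - ρ ^ K)`
  -- from the nonlinear term, except for a term of good sign.
  have hsum : ∀ K, partialTailExcess ρ K (q + h • fluidDrift q) ≤ partialTailExcess ρ K q
      + h * p (K + 1) - h * upperTail q 1 * p K - h * (p 1 * ρ ^ K) := by
    intro K
    induction K with
    | zero => simp [partialTailExcess, hpz]
    | succ K ih =>
      simp only [partialTailExcess] at ih ⊢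
      rw [Finset.sum_range_succ, Finset.sum_range_succ]
      have := hstep K
      have e : max (upperTail q (K + 1) - ρ ^ (K + 1)) 0 = p (K + 1) := rfl
      rw [e]
      linarith
  have hb : p (K + 1) ≤ upperTail q (K + 1) :=
    max_le (by linarith [hρk (K + 1)]) (upperTail_nonneg hq _)
  have c1 := mul_nonneg (mul_nonneg h0 hu0) (hp0 K)
  have c2 := mul_nonneg h0 (mul_nonneg (hp0 1) (hρk K))
  have c3 := mul_le_mul_of_nonneg_left hb h0
  linarith [hsum K]

end probLaws

theorem abs_upperTail_sub_le (p q : EllOne) (k : ℕ) :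
    |upperTail p k - upperTail q k| ≤ ‖p - q‖ := by
  have e : upperTail p k - upperTail q k = -∑ j ∈ Finset.range k, (p - q) j := by
    have e1 : ∀ j, (p - q) j = p j - q j := fun _ => rfl
    simp only [upperTail, e1, Finset.sum_sub_distrib]
    ring
  rw [e, abs_neg]
  exact (Finset.abs_sum_le_sum_abs _ _).trans
    (sum_le_hasSum _ (fun _ _ => abs_nonneg _) (p - q).hasSum_abs)

theorem partialTailExcess_sub_le (ρ : ℝ) (K : ℕ) (p q : EllOne) :
    partialTailExcess ρ K p - partialTailExcess ρ K q ≤ K * ‖p - q‖ := by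
  rw [partialTailExcess, partialTailExcess, ← Finset.sum_sub_distrib]
  refine (Finset.sum_le_card_nsmul _ _ ‖p - q‖ fun k _ => ?_).trans (le_of_eq (by simp))
  have h1 := (abs_le.1 (abs_upperTail_sub_le p q (k + 1))).2
  have h2 : 0 ≤ ‖p - q‖ := norm_nonneg _
  have h3 := le_max_left (upperTail q (k + 1) - ρ ^ (k + 1)) 0
  have h4 := le_max_right (upperTail q (k + 1) - ρ ^ (k + 1)) 0
  rw [sub_le_iff_le_add]
  exact max_le (by linarith) (by linarith)

theorem continuous_partialTailExcess (ρ : ℝ) (K : ℕ) : Continuous (partialTailExcess ρ K) := by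
  refine (LipschitzWith.of_le_add_mul (K : ℝ≥0) fun p q => ?_).continuous
  have := partialTailExcess_sub_le ρ K p q
  rw [dist_eq_norm]
  simpa using by linarith

/-- The sum of the positive parts of the tail differences between `q` and the geometric law with
ratio `ρ`. -/
noncomputable def tailExcess (ρ : ℝ) (q : EllOne) : ℝ :=
  ∑' k, max (upperTail q (k + 1) - ρ ^ (k + 1)) 0

theorem hasSum_tailExcess {q : EllOne} (hq : q ∈ probLaws) {m : ℝ}
    (hm : HasSum (fun k => upperTail q (k + 1)) m) {ρ : ℝ} (hρ : 0 ≤ ρ) :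
    HasSum (fun k => max (upperTail q (k + 1) - ρ ^ (k + 1)) 0) (tailExcess ρ q) :=
  (Summable.of_nonneg_of_le (fun _ => le_max_right _ _)
    (fun k => max_le (by linarith [pow_nonneg hρ (k + 1)]) (upperTail_nonneg hq _))
    hm.summable).hasSum

/-! ### Conservation of the mean and decay of the tail excess. -/

namespace IsFluidLimit

variable {q : EllOne} {x : ℝ → EllOne}

theorem hasDerivWithinAt_coord (hx : IsFluidLimit q x) {t : ℝ} (ht : 0 ≤ t) (k : ℕ) :
    HasDerivWithinAt (fun s => x s k) (fluidDrift (x t) k) (Set.Ici 0) t :=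
  (lp.evalCLM ℝ (fun _ : ℕ => ℝ) 1 k).hasFDerivAt.comp_hasDerivWithinAt t (hx.deriv t ht)

theorem hasDerivWithinAt_upperTail (hx : IsFluidLimit q x) (hq : q ∈ probLaws) {t : ℝ}
    (ht : 0 ≤ t) (k : ℕ) :
    HasDerivWithinAt (fun s => upperTail (x s) (k + 1)) (massFlux (x t) k) (Set.Ici 0) t := by
  have := (HasDerivWithinAt.fun_sum (u := Finset.range (k + 1))
    fun j _ => hx.hasDerivWithinAt_coord ht j).const_sub 1
  rwa [sum_fluidDrift (hx.mem_probLaws hq ht), neg_neg] at this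

theorem hasDerivWithinAt_sum_upperTail (hx : IsFluidLimit q x) (hq : q ∈ probLaws) {t : ℝ}
    (ht : 0 ≤ t) (K : ℕ) :
    HasDerivWithinAt (fun s => ∑ k ∈ Finset.range K, upperTail (x s) (k + 1))
      (upperTail (x t) (K + 1) - upperTail (x t) 1 * upperTail (x t) K) (Set.Ici 0) t := by
  rw [← sum_massFlux]
  exact HasDerivWithinAt.fun_sum fun k _ => hx.hasDerivWithinAt_upperTail hq ht k

/-- The fluxes telescope to `S_{K+1} - u S_K`, which lies in `[-S_K, S_K]`. -/
theorem abs_sum_upperTail_sub_le (hx : IsFluidLimit q x) (hq : q ∈ probLaws) {t : ℝ}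
    (ht : 0 ≤ t) (K : ℕ) {C : ℝ} (hC : ∀ s, 0 ≤ s → s ≤ t → upperTail (x s) K ≤ C) :
    |∑ k ∈ Finset.range K, upperTail (x t) (k + 1) - ∑ k ∈ Finset.range K, upperTail q (k + 1)|
      ≤ C * t := by
  have := norm_image_sub_le_of_norm_deriv_right_le_segment (a := 0) (b := t) (C := C)
    (f := fun s => ∑ k ∈ Finset.range K, upperTail (x s) (k + 1))
    (fun s hs => ((hx.hasDerivWithinAt_sum_upperTail hq hs.1 K).continuousWithinAt).mono
      Set.Icc_subset_Ici_self)
    (fun s hs => (hx.hasDerivWithinAt_sum_upperTail hq hs.1 K).mono (Set.Ici_subset_Ici.2 hs.1))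
    (fun s hs => ?_) t ⟨ht, le_rfl⟩
  · simpa [hx.initial] using this
  · have hs' := hx.mem_probLaws hq hs.1
    have h1 := upperTail_nonneg hs' (K + 1)
    have h2 := upperTail_antitone hs' (Nat.le_succ K)
    have h3 := hC s hs.1 hs.2.le
    have h4 := mul_nonneg (upperTail_nonneg hs' 1) (upperTail_nonneg hs' K)
    have h5 := mul_le_of_le_one_left (upperTail_nonneg hs' K) (upperTail_le_one hs' 1)
    rw [Real.norm_eq_abs, abs_le]
    constructor <;> linarith

/-- The mean is conserved. -/
theorem hasSum_upperTail_mean (hx : IsFluidLimit q x) (hq : q ∈ probLaws) {m : ℝ}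
    (hm : HasSum (fun k => upperTail q (k + 1)) m) {t : ℝ} (ht : 0 ≤ t) :
    HasSum (fun k => upperTail (x t) (k + 1)) m := by
  -- Bootstrap: the crude bound `S_K ≤ 1` gives `S_K ≤ (m + t) / K`, which is fed back into the same
  -- estimate and makes the error vanish as `K → ∞`.
  have hbound : ∀ s, 0 ≤ s → s ≤ t → ∀ K : ℕ, K * upperTail (x s) K ≤ m + t := by
    intro s hs hst K
    have h1 := hx.abs_sum_upperTail_sub_le hq hs K (C := 1) fun r hr _ =>
      upperTail_le_one (hx.mem_probLaws hq hr) K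
    have h2 := mul_upperTail_le_sum (hx.mem_probLaws hq hs) K
    have h3 := sum_le_hasSum (Finset.range K) (fun k _ => upperTail_nonneg hq (k + 1)) hm
    linarith [(abs_le.1 h1).2]
  rw [hasSum_iff_tendsto_nat_of_nonneg fun k => upperTail_nonneg (hx.mem_probLaws hq ht) _]
  have hlim : Filter.Tendsto (fun K : ℕ => (m + t) / K * t) Filter.atTop (𝓝 0) := by
    simpa using (tendsto_const_div_atTop_nhds_zero_nat (m + t)).mul_const t
  have hdiff := squeeze_zero_norm' (f := fun K => ∑ k ∈ Finset.range K, upperTail (x t) (k + 1)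
      - ∑ k ∈ Finset.range K, upperTail q (k + 1)) ?_ hlim
  · simpa using hdiff.add hm.tendsto_sum_nat
  · filter_upwards [Filter.eventually_gt_atTop 0] with K hK
    refine hx.abs_sum_upperTail_sub_le hq ht K fun s hs hst => ?_
    rw [le_div_iff₀ (by exact_mod_cast hK), mul_comm]
    exact hbound s hs hst K

theorem partialTailExcess_le (hx : IsFluidLimit q x) (hq : q ∈ probLaws) {m : ℝ}
    (hm : HasSum (fun k => upperTail q (k + 1)) m) {ρ : ℝ} (hρ0 : 0 ≤ ρ) (hρ1 : ρ ≤ 1) (K : ℕ)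
    {s t : ℝ} (hs : 0 ≤ s) (hst : s ≤ t) :
    partialTailExcess ρ K (x t)
      ≤ partialTailExcess ρ K (x s) + m / (K + 1 : ℕ) * (t - s) := by
  have key := le_gronwallBound_of_liminf_deriv_right_le
    (f := fun r => partialTailExcess ρ K (x r)) (f' := fun r => upperTail (x r) (K + 1))
    (δ := partialTailExcess ρ K (x s)) (K := 0) (ε := m / (K + 1 : ℕ)) (a := s) (b := t)
    ?_ ?_ le_rfl ?_ t ⟨hst, le_rfl⟩
  · rwa [gronwallBound_K0] at key
  · exact (continuous_partialTailExcess ρ K).comp_continuousOn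
      (hx.continuousOn.mono fun r hr => hs.trans hr.1)
  · intro r hr c hc
    refine (eventually_slope_lt_of_euler_step (partialTailExcess_sub_le ρ K)
      (hx.hasDerivWithinAt_right (hs.trans hr.1)) ?_ hc).frequently
    filter_upwards [Ioo_mem_nhdsGT (by norm_num : (0 : ℝ) < 1 / 2)] with h hh
    exact partialTailExcess_euler_step_le (hx.mem_probLaws hq (hs.trans hr.1)) hρ0 hρ1 K hh.1.le
      (by linarith [hh.2])
  · intro r hr
    rw [zero_mul, zero_add]
    exact upperTail_le_div (hx.mem_probLaws hq (hs.trans hr.1))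
      (hx.hasSum_upperTail_mean hq hm (hs.trans hr.1)) K.succ_pos

theorem tailExcess_antitoneOn (hx : IsFluidLimit q x) (hq : q ∈ probLaws) {m : ℝ}
    (hm : HasSum (fun k => upperTail q (k + 1)) m) {ρ : ℝ} (hρ0 : 0 ≤ ρ) (hρ1 : ρ ≤ 1) :
    AntitoneOn (fun t => tailExcess ρ (x t)) (Set.Ici 0) := by
  intro s hs t ht hst
  have hsum : ∀ r, 0 ≤ r → Filter.Tendsto (fun K => partialTailExcess ρ K (x r)) Filter.atTop
      (𝓝 (tailExcess ρ (x r))) := fun r hr =>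
    (hasSum_tailExcess (hx.mem_probLaws hq hr) (hx.hasSum_upperTail_mean hq hm hr)
      hρ0).tendsto_sum_nat
  have hlim := (hsum s hs).add (((Filter.tendsto_add_atTop_iff_nat 1).2
    (tendsto_const_div_atTop_nhds_zero_nat m)).mul_const (t - s))
  rw [zero_mul, add_zero] at hlim
  exact le_of_tendsto_of_tendsto' (hsum t ht) hlim fun K =>
    hx.partialTailExcess_le hq hm hρ0 hρ1 K hs hst

end IsFluidLimit

/-! ### Strict positivity and entropy dissipation. -/

theorem hasDerivAt_exp_two_mul_mul {y y' : ℝ → ℝ}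
    (hy : ∀ t, 0 ≤ t → HasDerivWithinAt y (y' t) (Set.Ici 0) t) {t : ℝ} (ht : 0 < t) :
    HasDerivAt (fun s => Real.exp (2 * s) * y s) (Real.exp (2 * t) * (2 * y t + y' t)) t := by
  have h1 := (hy t ht.le).hasDerivAt (Ici_mem_nhds ht)
  have h2 : HasDerivAt (fun s : ℝ => Real.exp (2 * s)) (Real.exp (2 * t) * (2 * 1)) t :=
    ((hasDerivAt_id t).const_mul 2).exp
  convert! h2.fun_mul h1 using 1
  ring

theorem continuousOn_exp_two_mul_mul {y y' : ℝ → ℝ}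
    (hy : ∀ t, 0 ≤ t → HasDerivWithinAt y (y' t) (Set.Ici 0) t) :
    ContinuousOn (fun s => Real.exp (2 * s) * y s) (Set.Ici 0) :=
  (by fun_prop : Continuous fun s : ℝ => Real.exp (2 * s)).continuousOn.mul
    fun t ht => (hy t ht).continuousWithinAt

/-- The integrating factor `exp (2 * t)` suits the fluid equation, where a site loses mass at rate
at most `1 + u ≤ 2`. -/
theorem pos_of_pos_initial {y y' : ℝ → ℝ}
    (hy : ∀ t, 0 ≤ t → HasDerivWithinAt y (y' t) (Set.Ici 0) t)
    (hy' : ∀ t, 0 ≤ t → 0 ≤ 2 * y t + y' t) (h0 : 0 < y 0) {t : ℝ} (ht : 0 ≤ t) : 0 < y t := by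
  have hmono : MonotoneOn (fun s => Real.exp (2 * s) * y s) (Set.Ici 0) := by
    refine monotoneOn_of_hasDerivWithinAt_nonneg (convex_Ici 0) (continuousOn_exp_two_mul_mul hy)
      (f' := fun s => Real.exp (2 * s) * (2 * y s + y' s)) (fun s hs => ?_) fun s hs => ?_
    all_goals rw [interior_Ici] at hs
    · exact (hasDerivAt_exp_two_mul_mul hy hs).hasDerivWithinAt
    · exact mul_nonneg (Real.exp_pos _).le (hy' s (le_of_lt hs))
  have h := hmono Set.self_mem_Ici ht ht
  simp only [mul_zero, Real.exp_zero, one_mul] at h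
  exact pos_of_mul_pos_right (h0.trans_le h) (Real.exp_pos _).le

theorem pos_of_pos_source {y y' : ℝ → ℝ}
    (hy : ∀ t, 0 ≤ t → HasDerivWithinAt y (y' t) (Set.Ici 0) t)
    (hy' : ∀ t, 0 < t → 0 < 2 * y t + y' t) (h0 : 0 ≤ y 0) {t : ℝ} (ht : 0 < t) : 0 < y t := by
  have hmono : StrictMonoOn (fun s => Real.exp (2 * s) * y s) (Set.Ici 0) := by
    refine strictMonoOn_of_hasDerivWithinAt_pos (convex_Ici 0) (continuousOn_exp_two_mul_mul hy)
      (f' := fun s => Real.exp (2 * s) * (2 * y s + y' s)) (fun s hs => ?_) fun s hs => ?_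
    all_goals rw [interior_Ici] at hs
    · exact (hasDerivAt_exp_two_mul_mul hy hs).hasDerivWithinAt
    · exact mul_pos (Real.exp_pos _) (hy' s hs)
  have h := hmono Set.self_mem_Ici ht.le ht
  simp only [mul_zero, Real.exp_zero, one_mul] at h
  exact pos_of_mul_pos_right (h0.trans_lt h) (Real.exp_pos _).le

/-- The logarithm has slope at least 1 on `(0, 1]`. This turns entropy dissipation into squared
fluxes. -/
theorem sq_sub_le_mul_log_sub_log {a b : ℝ} (ha : 0 < a) (ha1 : a ≤ 1) (hb : 0 < b) (hb1 : b ≤ 1) :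
    (a - b) ^ 2 ≤ (a - b) * (Real.log a - Real.log b) := by
  have key : ∀ {a b : ℝ}, 0 < a → a ≤ 1 → 0 < b → b ≤ a → a - b ≤ Real.log a - Real.log b := by
    intro a b ha ha1 hb hab
    have h := Real.one_sub_inv_le_log_of_pos (div_pos ha hb)
    rw [Real.log_div ha.ne' hb.ne', inv_div] at h
    refine le_trans ?_ h
    have e : 1 - b / a = (a - b) / a := by field_simp
    rw [e, le_div_iff₀ ha]
    exact mul_le_of_le_one_right (sub_nonneg.2 hab) ha1
  rcases le_total b a with h | h
  · nlinarith [key ha ha1 hb h]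
  · nlinarith [key hb hb1 ha h]

theorem neg_mul_log_le_two_mul_sqrt {a : ℝ} (ha : 0 < a) : -(a * Real.log a) ≤ 2 * √a := by
  have hs := Real.sqrt_pos.2 ha
  have h := Real.one_sub_inv_le_log_of_pos hs
  rw [Real.log_sqrt ha.le] at h
  have h2 : -(a * Real.log a) ≤ a * (2 * (√a)⁻¹ - 2) := by nlinarith
  have h3 : a * (√a)⁻¹ = √a := by
    rw [← div_eq_mul_inv, Real.div_sqrt]
  nlinarith

section probLaws

variable {q : EllOne} (hq : q ∈ probLaws)
include hq

theorem le_two_mul_add_fluidDrift (k : ℕ) : q (k + 1) ≤ 2 * q k + fluidDrift q k := by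
  have h1 := mul_le_of_le_one_left (hq.1 k) (upperTail_le_one hq 1)
  rcases k with _ | k
  · rw [fluidDrift_zero hq, massFlux]
    linarith [hq.1 0]
  · rw [fluidDrift_succ hq, massFlux, massFlux]
    linarith [mul_nonneg (upperTail_nonneg hq 1) (hq.1 k), hq.1 (k + 1)]

theorem mul_le_two_mul_add_fluidDrift_succ (k : ℕ) :
    upperTail q 1 * q k ≤ 2 * q (k + 1) + fluidDrift q (k + 1) := by
  have h1 := mul_le_of_le_one_left (hq.1 (k + 1)) (upperTail_le_one hq 1)
  rw [fluidDrift_succ hq, massFlux, massFlux]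
  linarith [hq.1 (k + 1 + 1)]

theorem sum_log_mul_fluidDrift (K : ℕ) :
    ∑ k ∈ Finset.range (K + 1), (Real.log (q k) + 1) * fluidDrift q k
      = ∑ k ∈ Finset.range K, massFlux q k * (Real.log (q (k + 1)) - Real.log (q k))
        - massFlux q K * (Real.log (q K) + 1) := by
  induction K with
  | zero => simp [fluidDrift_zero hq]; ring
  | succ K ih => rw [Finset.sum_range_succ, ih, Finset.sum_range_succ, fluidDrift_succ hq]; ring

/-- After summation by parts, compare `log q_{k+1}` with `log (u q_k)`. The correction is `log u`
times the telescoping sum of the fluxes, so it and the boundary term at `K` are controlled by `S_K`.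
-/
theorem sum_log_mul_fluidDrift_le (hpos : ∀ k, 0 < q k) (K : ℕ) :
    ∑ k ∈ Finset.range (K + 1), (Real.log (q k) + 1) * fluidDrift q k
      ≤ -∑ k ∈ Finset.range K, massFlux q k ^ 2 + (2 * upperTail q K + 2 * √(upperTail q K)) := by
  have hle1 : ∀ k, q k ≤ 1 := fun k => (le_upperTail hq k).trans (upperTail_le_one hq k)
  have hu : 0 < upperTail q 1 := (hpos 1).trans_le (le_upperTail hq 1)
  have hu1 := upperTail_le_one hq 1
  have hterm : ∀ k, massFlux q k * (Real.log (q (k + 1)) - Real.log (q k))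
      ≤ -massFlux q k ^ 2 + massFlux q k * Real.log (upperTail q 1) := by
    intro k
    have h := sq_sub_le_mul_log_sub_log (mul_pos hu (hpos k)) (mul_le_one₀ hu1 (hpos k).le (hle1 k))
      (hpos (k + 1)) (hle1 (k + 1))
    rw [Real.log_mul hu.ne' (hpos k).ne'] at h
    rw [massFlux]
    linarith
  have hsum := Finset.sum_le_sum fun k (_ : k ∈ Finset.range K) => hterm k
  rw [Finset.sum_add_distrib, Finset.sum_neg_distrib, ← Finset.sum_mul, sum_massFlux] at hsum
  rw [sum_log_mul_fluidDrift hq, massFlux]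
  have hlogu : Real.log (upperTail q 1) ≤ 0 := Real.log_nonpos hu.le hu1
  have hlogq : Real.log (q K) ≤ 0 := Real.log_nonpos (hpos K).le (hle1 K)
  have hS := upperTail_nonneg hq K
  have hS1 := upperTail_nonneg hq (K + 1)
  have hulog : -(upperTail q 1 * Real.log (upperTail q 1)) ≤ 1 := by
    have h := Real.one_sub_inv_le_log_of_pos hu
    have h2 := mul_le_mul_of_nonneg_left h hu.le
    rw [mul_sub, mul_inv_cancel₀ hu.ne'] at h2
    linarith
  have a1 : upperTail q (K + 1) * Real.log (upperTail q 1) ≤ 0 :=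
    mul_nonpos_of_nonneg_of_nonpos hS1 hlogu
  have a2 := mul_le_mul_of_nonneg_right hulog hS
  have a3 : q (K + 1) * Real.log (q K) ≤ 0 :=
    mul_nonpos_of_nonneg_of_nonpos (hpos _).le hlogq
  have a4 : -(q K * Real.log (q K)) ≤ 2 * √(upperTail q K) :=
    (neg_mul_log_le_two_mul_sqrt (hpos K)).trans (by gcongr; exact le_upperTail hq K)
  have a5 : -(upperTail q 1 * (q K * Real.log (q K))) ≤ -(q K * Real.log (q K)) := by
    have : q K * Real.log (q K) ≤ 0 := mul_nonpos_of_nonneg_of_nonpos (hpos _).le hlogq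
    nlinarith
  have a6 : q (K + 1) ≤ upperTail q K :=
    (le_upperTail hq _).trans (upperTail_antitone hq K.le_succ)
  have a7 := mul_nonneg hu.le (hpos K).le
  linarith

end probLaws

namespace IsFluidLimit

variable {q : EllOne} {x : ℝ → EllOne}

/-- A positive mean gives an occupied site other than 0, which stays occupied. Departures spread
positivity down to 0, and since `u > 0`, arrivals then spread it to all sites. -/
theorem coord_pos (hx : IsFluidLimit q x) (hq : q ∈ probLaws) {m : ℝ}
    (hm : HasSum (fun k => upperTail q (k + 1)) m) (hm0 : 0 < m) {t : ℝ} (ht : 0 < t) (k : ℕ) :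
    0 < x t k := by
  have hP : ∀ s, 0 ≤ s → x s ∈ probLaws := fun s hs => hx.mem_probLaws hq hs
  obtain ⟨i, hi⟩ : ∃ i, 0 < q (i + 1) := by
    by_contra! h
    have h0 : upperTail q 1 ≤ 0 :=
      hasSum_le (fun i => h i) (hasSum_upperTail hq 1) hasSum_zero
    have := hasSum_le (fun k => (upperTail_antitone hq (Nat.le_add_left 1 k)).trans h0) hm
      hasSum_zero
    linarith
  have hi' : ∀ s, 0 ≤ s → 0 < x s (i + 1) := fun s hs =>
    pos_of_pos_initial (y := fun s => x s (i + 1))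
      (fun r hr => hx.hasDerivWithinAt_coord hr (i + 1))
      (fun r hr => ((hP r hr).1 _).trans (le_two_mul_add_fluidDrift (hP r hr) (i + 1)))
      (by rwa [hx.initial]) hs
  have hdown : ∀ j ≤ i + 1, ∀ s, 0 < s → 0 < x s j := by
    intro j hj
    induction hj using Nat.decreasingInduction with
    | self => exact fun s hs => hi' s hs.le
    | of_succ j _ ih =>
      exact fun s hs => pos_of_pos_source (y := fun s => x s j)
        (fun r hr => hx.hasDerivWithinAt_coord hr j)
        (fun r hr => (ih r hr).trans_le (le_two_mul_add_fluidDrift (hP r hr.le) j))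
        ((hP 0 le_rfl).1 j) hs
  have hu : ∀ s, 0 ≤ s → 0 < upperTail (x s) 1 := fun s hs =>
    (hi' s hs).trans_le ((le_upperTail (hP s hs) _).trans
      (upperTail_antitone (hP s hs) (Nat.le_add_left 1 i)))
  induction k generalizing t with
  | zero => exact hdown 0 (Nat.zero_le _) t ht
  | succ k ih =>
    exact pos_of_pos_source (y := fun s => x s (k + 1))
      (fun r hr => hx.hasDerivWithinAt_coord hr (k + 1))
      (fun r hr => (mul_pos (hu r hr.le) (ih hr)).trans_le
        (mul_le_two_mul_add_fluidDrift_succ (hP r hr.le) k))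
      ((hP 0 le_rfl).1 _) ht

/-- Entropy dissipation: there are arbitrarily late times at which the mass fluxes are small. -/
theorem exists_massFlux_small (hx : IsFluidLimit q x) (hq : q ∈ probLaws) {m : ℝ}
    (hm : HasSum (fun k => upperTail q (k + 1)) m) (hm0 : 0 < m) (N : ℕ) {ε : ℝ} (hε : 0 < ε)
    (T : ℝ) : ∃ t, T ≤ t ∧ 0 < t ∧ ∀ k < N, massFlux (x t) k ^ 2 < ε := by
  by_contra! hcon
  -- Since `S_K ≤ m / K` at all times, this truncation level keeps the boundary terms below half the
  -- supposed dissipation `ε`.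
  obtain ⟨K, hK0, hKN, hK⟩ : ∃ K : ℕ, 0 < K ∧ N ≤ K ∧ 2 * (m / K) + 2 * √(m / K) < ε / 2 := by
    have h1 : Filter.Tendsto (fun K : ℕ => m / K) Filter.atTop (𝓝 0) :=
      tendsto_const_div_atTop_nhds_zero_nat m
    have h2 : Filter.Tendsto (fun K : ℕ => 2 * (m / K) + 2 * √(m / K)) Filter.atTop (𝓝 0) := by
      simpa using (h1.const_mul 2).add (h1.sqrt.const_mul 2)
    have h3 := h2.eventually_lt_const (half_pos hε)
    obtain ⟨K, hK⟩ := (h3.and ((Filter.eventually_ge_atTop N).and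
      (Filter.eventually_gt_atTop 0))).exists
    exact ⟨K, hK.2.2, hK.2.1, hK.1⟩
  set τ := max T 1 with hτ
  have hτ1 : 1 ≤ τ := le_max_right _ _
  have hpos : ∀ t, τ ≤ t → ∀ k, 0 < x t k := fun t ht k =>
    hx.coord_pos hq hm hm0 (by linarith) k
  set H : ℝ → ℝ := fun t => ∑ k ∈ Finset.range (K + 1), x t k * Real.log (x t k) with hH
  have hder : ∀ t, τ ≤ t → HasDerivWithinAt H
      (∑ k ∈ Finset.range (K + 1), (Real.log (x t k) + 1) * fluidDrift (x t) k) (Set.Ici τ) t := by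
    intro t ht
    refine HasDerivWithinAt.fun_sum fun k _ => ?_
    exact (Real.hasDerivAt_mul_log (hpos t ht k).ne').comp_hasDerivWithinAt t
      ((hx.hasDerivWithinAt_coord (zero_le_one.trans (hτ1.trans ht)) k).mono
        (Set.Ici_subset_Ici.2 (zero_le_one.trans hτ1)))
  have hdec : ∀ t, τ ≤ t →
      ∑ k ∈ Finset.range (K + 1), (Real.log (x t k) + 1) * fluidDrift (x t) k ≤ -(ε / 2) := by
    intro t ht
    have ht0 : 0 < t := by linarith
    have hP := hx.mem_probLaws hq ht0.le
    have h1 := sum_log_mul_fluidDrift_le hP (hpos t ht) K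
    have h2 := upperTail_le_div hP (hx.hasSum_upperTail_mean hq hm ht0.le) hK0
    have h3 := Real.sqrt_le_sqrt h2
    obtain ⟨k, hk, hkε⟩ := hcon t ((le_max_left _ _).trans ht) ht0
    have h4 := Finset.single_le_sum (f := fun k => massFlux (x t) k ^ 2)
      (fun k _ => sq_nonneg _) (Finset.mem_range.2 (hk.trans_le hKN))
    linarith
  have hanti : AntitoneOn (fun t => H t + ε / 2 * t) (Set.Ici τ) := by
    have hd : ∀ t, τ ≤ t → HasDerivWithinAt (fun t => H t + ε / 2 * t) _ (Set.Ici τ) t :=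
      fun t ht => (hder t ht).fun_add (((hasDerivAt_id t).const_mul (ε / 2)).hasDerivWithinAt)
    refine antitoneOn_of_hasDerivWithinAt_nonpos (convex_Ici τ)
      (fun t ht => (hd t ht).continuousWithinAt)
      (fun t ht => (hd t (interior_subset ht)).mono interior_subset) fun t ht => ?_
    have := hdec t (interior_subset ht)
    linarith
  have hup : H τ ≤ 0 := Finset.sum_nonpos fun k _ => by
    have hP := hx.mem_probLaws hq (zero_le_one.trans hτ1)
    exact mul_nonpos_of_nonneg_of_nonpos (hP.1 k) (Real.log_nonpos (hP.1 k)
      ((le_upperTail hP k).trans (upperTail_le_one hP k)))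
  have hlow : ∀ t, τ ≤ t → -(K + 1 : ℝ) ≤ H t := by
    intro t ht
    have := Finset.card_nsmul_le_sum (Finset.range (K + 1))
      (fun k => x t k * Real.log (x t k)) (-1) fun k _ => by
        have h := Real.one_sub_inv_le_log_of_pos (hpos t ht k)
        have h2 := mul_le_mul_of_nonneg_left h (hpos t ht k).le
        rw [mul_sub, mul_inv_cancel₀ (hpos t ht k).ne'] at h2
        linarith [hpos t ht k]
    simpa using this
  -- Over time `d` the entropy would drop by at least `K + 2`, but it stays above `-(K + 1)` and
  -- starts at most 0.
  obtain ⟨d, hd⟩ : ∃ d, d = 2 * (K + 2 : ℝ) / ε := ⟨_, rfl⟩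
  have hd0 : 0 ≤ d := hd ▸ by positivity
  have hdε : ε / 2 * d = K + 2 := by rw [hd]; field_simp
  have h1 := hanti Set.self_mem_Ici (Set.mem_Ici.2 (le_add_of_nonneg_right hd0))
    (le_add_of_nonneg_right hd0)
  have h2 := hlow (τ + d) (le_add_of_nonneg_right hd0)
  simp only [mul_add] at h1
  linarith

end IsFluidLimit

/-! ### Limits of the tail excess and its control of the norm. -/

theorem tailExcess_nonneg (ρ : ℝ) (q : EllOne) : 0 ≤ tailExcess ρ q :=
  tsum_nonneg fun _ => le_max_right _ _

section probLaws

variable {q : EllOne} (hq : q ∈ probLaws) {m : ℝ} (hm : HasSum (fun k => upperTail q (k + 1)) m)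
include hq hm

theorem tailExcess_le {ρ : ℝ} (hρ : 0 ≤ ρ) : tailExcess ρ q ≤ m :=
  hasSum_le (fun k => max_le (by linarith [pow_nonneg hρ (k + 1)]) (upperTail_nonneg hq _))
    (hasSum_tailExcess hq hm hρ) hm

/-- In this form the sum is dominated by `ρ ^ (k + 1)` uniformly over laws of mean `m`, so for `ρ <
1` limits pass through it without uniform integrability. -/
theorem tailExcess_eq_sub_tsum_min {ρ : ℝ} (hρ : 0 ≤ ρ) :
    tailExcess ρ q = m - ∑' k, min (upperTail q (k + 1)) (ρ ^ (k + 1)) := by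
  have h := hm.sub (hasSum_tailExcess hq hm hρ)
  have e : (fun k => upperTail q (k + 1) - max (upperTail q (k + 1) - ρ ^ (k + 1)) 0)
      = fun k => min (upperTail q (k + 1)) (ρ ^ (k + 1)) := by
    funext k
    rcases le_total (upperTail q (k + 1)) (ρ ^ (k + 1)) with h | h
    · rw [max_eq_right (by linarith), min_eq_left h]; ring
    · rw [max_eq_left (by linarith), min_eq_right h]; ring
  rw [e] at h
  rw [h.tsum_eq]; ring

theorem tendsto_tailExcess_one :
    Filter.Tendsto (fun n : ℕ => tailExcess (1 - 1 / ((n : ℝ) + 1)) q) Filter.atTop (𝓝 0) := by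
  have hρ : Filter.Tendsto (fun n : ℕ => 1 - 1 / ((n : ℝ) + 1)) Filter.atTop (𝓝 1) := by
    simpa using tendsto_one_div_add_atTop_nhds_zero_nat.const_sub (1 : ℝ)
  have hρ0 : ∀ n : ℕ, (0 : ℝ) ≤ 1 - 1 / ((n : ℝ) + 1) := fun n => by
    rw [sub_nonneg, div_le_one (by positivity)]
    linarith [(n.cast_nonneg : (0 : ℝ) ≤ n)]
  have h := tendsto_tsum_of_dominated_convergence (𝓕 := Filter.atTop)
    (f := fun (n : ℕ) k => max (upperTail q (k + 1) - (1 - 1 / ((n : ℝ) + 1)) ^ (k + 1)) 0)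
    (g := fun _ => (0 : ℝ)) hm.summable (fun k => ?_) (Filter.Eventually.of_forall fun n k => ?_)
  · simpa [tailExcess] using h
  · have h1 := ((hρ.pow (k + 1)).const_sub (upperTail q (k + 1))).max (tendsto_const_nhds (x := 0))
    rwa [one_pow, max_eq_right (sub_nonpos.2 (upperTail_le_one hq _))] at h1
  · rw [Real.norm_of_nonneg (le_max_right _ _)]
    exact max_le (by linarith [pow_nonneg (hρ0 n) (k + 1)]) (upperTail_nonneg hq _)

/-- Equal means make the tail differences sum to 0, so their absolute values sum to twice the
positive parts. Point masses are differences of consecutive tails, which costs another factor 2. -/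
theorem norm_sub_geometricLaw_le {lam : ℝ≥0} (hlam : m = lam) :
    ‖q - geometricLaw lam‖ ≤ 4 * tailExcess (lam / (1 + lam)) q := by
  set r : ℝ := lam / (1 + lam) with hr
  have hl : (0 : ℝ) ≤ lam := lam.2
  have hr0 : 0 ≤ r := by positivity
  have hr1 : r < 1 := by rw [hr, div_lt_one (by positivity)]; linarith
  have h1r : 1 - r = 1 / (1 + lam) := by
    rw [hr]; field_simp; ring
  have hgeo : HasSum (fun k => r ^ (k + 1)) m := by
    have h := (hasSum_geometric_of_lt_one hr0 hr1).mul_left r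
    have e : r * (1 - r)⁻¹ = m := by rw [h1r, hr, hlam]; field_simp
    rw [e] at h
    simpa [pow_succ'] using h
  have hD := hm.sub hgeo
  have hE := hasSum_tailExcess hq hm hr0
  have habs : HasSum (fun k => |upperTail q (k + 1) - r ^ (k + 1)|) (2 * tailExcess r q) := by
    have h := (hE.mul_left 2).sub hD
    rw [sub_self, sub_zero] at h
    convert! h using 2 with k
    rcases le_total (upperTail q (k + 1) - r ^ (k + 1)) 0 with h | h
    · rw [max_eq_right h, abs_of_nonpos h]; ring
    · rw [max_eq_left h, abs_of_nonneg h]; ring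
  have habs' : HasSum (fun k => |upperTail q k - r ^ k|) (2 * tailExcess r q) := by
    rw [← hasSum_nat_add_iff' 1]
    simpa [upperTail_zero] using habs
  refine (hasSum_le (fun k => ?_) (q - geometricLaw lam).hasSum_abs
    (habs'.add habs)).trans (le_of_eq (by ring))
  have e : (q - geometricLaw lam) k
      = (upperTail q k - r ^ k) - (upperTail q (k + 1) - r ^ (k + 1)) := by
    have e1 : (q - geometricLaw lam) k = q k - 1 / (1 + (lam : ℝ)) * r ^ k := rfl
    rw [e1, ← h1r, upperTail_succ]; ring
  rw [e]
  exact abs_sub _ _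

end probLaws

/-- Along a sequence whose mass fluxes vanish, the tails become geometric
once the arrival rates converge. -/
theorem tendsto_upperTail_of_massFlux {p : ℕ → EllOne} {u : ℝ}
    (hu : Filter.Tendsto (fun n => upperTail (p n) 1) Filter.atTop (𝓝 u))
    (hJ : ∀ k, Filter.Tendsto (fun n => massFlux (p n) k) Filter.atTop (𝓝 0)) (k : ℕ) :
    Filter.Tendsto (fun n => upperTail (p n) k) Filter.atTop (𝓝 (u ^ k)) := by
  have hcoord : ∀ k, Filter.Tendsto (fun n => p n k) Filter.atTop (𝓝 ((1 - u) * u ^ k)) := by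
    intro k
    induction k with
    | zero =>
      have := hu.const_sub 1
      simpa [upperTail] using this
    | succ k ih =>
      have := (hu.mul ih).sub (hJ k)
      convert! this using 2
      · simp [massFlux]
      · ring
  induction k with
  | zero => simp [upperTail_zero]
  | succ k ih =>
    have := ih.sub (hcoord k)
    convert! this using 2
    · rw [upperTail_succ]
    · ring

theorem tendsto_tailExcess_of_upperTail {p : ℕ → EllOne} (hp : ∀ n, p n ∈ probLaws) {m u ρ : ℝ}
    (hm : ∀ n, HasSum (fun k => upperTail (p n) (k + 1)) m)
    (hS : ∀ k, Filter.Tendsto (fun n => upperTail (p n) k) Filter.atTop (𝓝 (u ^ k)))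
    (hρ0 : 0 ≤ ρ) (hρ1 : ρ < 1) :
    Filter.Tendsto (fun n => tailExcess ρ (p n)) Filter.atTop
      (𝓝 (m - ∑' k, min (u ^ (k + 1)) (ρ ^ (k + 1)))) := by
  simp only [fun n => tailExcess_eq_sub_tsum_min (hp n) (hm n) hρ0]
  refine Filter.Tendsto.const_sub m ?_
  refine tendsto_tsum_of_dominated_convergence (bound := fun k => ρ ^ (k + 1)) ?_ (fun k => ?_)
    (Filter.Eventually.of_forall fun n k => ?_)
  · exact (summable_nat_add_iff 1).2 (summable_geometric_of_lt_one hρ0 hρ1)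
  · exact (hS (k + 1)).min tendsto_const_nhds
  · rw [Real.norm_of_nonneg (le_min (upperTail_nonneg (hp n) _) (pow_nonneg hρ0 _))]
    exact min_le_right _ _

/-! ### Identification of the limit and convergence. -/

namespace IsFluidLimit

variable {q : EllOne} {x : ℝ → EllOne}

theorem exists_seq_massFlux_tendsto (hx : IsFluidLimit q x) (hq : q ∈ probLaws) {m : ℝ}
    (hm : HasSum (fun k => upperTail q (k + 1)) m) (hm0 : 0 < m) :
    ∃ τ : ℕ → ℝ, (∀ n, 0 ≤ τ n) ∧ ∃ u,
      Filter.Tendsto (fun n => upperTail (x (τ n)) 1) Filter.atTop (𝓝 u) ∧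
      0 ≤ u ∧ u ≤ 1 ∧
      ∀ k, Filter.Tendsto (fun n => massFlux (x (τ n)) k) Filter.atTop (𝓝 0) := by
  choose σ _ hσ0 hσ using fun n : ℕ => hx.exists_massFlux_small hq hm hm0 n
    (ε := 1 / ((n : ℝ) + 1)) (by positivity) 0
  have hJ : ∀ k, Filter.Tendsto (fun n => massFlux (x (σ n)) k) Filter.atTop (𝓝 0) := by
    intro k
    have h : Filter.Tendsto (fun n => massFlux (x (σ n)) k ^ 2) Filter.atTop (𝓝 0) := by
      refine squeeze_zero' (Filter.Eventually.of_forall fun n => sq_nonneg _) ?_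
        (tendsto_one_div_add_atTop_nhds_zero_nat (𝕜 := ℝ))
      filter_upwards [Filter.eventually_gt_atTop k] with n hn
      exact (hσ n k hn).le
    have h2 := h.sqrt
    simp only [Real.sqrt_sq_eq_abs, Real.sqrt_zero] at h2
    exact (tendsto_zero_iff_abs_tendsto_zero _).2 h2
  have hmem : ∀ n, upperTail (x (σ n)) 1 ∈ Set.Icc (0 : ℝ) 1 := fun n =>
    ⟨upperTail_nonneg (hx.mem_probLaws hq (hσ0 n).le) 1,
      upperTail_le_one (hx.mem_probLaws hq (hσ0 n).le) 1⟩
  obtain ⟨u, hu, φ, hφ, hlim⟩ := isCompact_Icc.tendsto_subseq hmem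
  exact ⟨σ ∘ φ, fun n => (hσ0 _).le, u, hlim, hu.1, hu.2, fun k => (hJ k).comp hφ.tendsto_atTop⟩

theorem exists_seq_tailExcess_tendsto (hx : IsFluidLimit q x) (hq : q ∈ probLaws) {m : ℝ}
    (hm : HasSum (fun k => upperTail q (k + 1)) m) (hm0 : 0 < m) :
    ∃ τ : ℕ → ℝ, (∀ n, 0 ≤ τ n) ∧
      Filter.Tendsto (fun n => tailExcess (m / (1 + m)) (x (τ n))) Filter.atTop (𝓝 0) := by
  obtain ⟨τ, hτ, u, hu, hu0, hu1, hJ⟩ := hx.exists_seq_massFlux_tendsto hq hm hm0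
  refine ⟨τ, hτ, ?_⟩
  have hP : ∀ n, x (τ n) ∈ probLaws := fun n => hx.mem_probLaws hq (hτ n)
  have hM : ∀ n, HasSum (fun k => upperTail (x (τ n)) (k + 1)) m := fun n =>
    hx.hasSum_upperTail_mean hq hm (hτ n)
  have hS := tendsto_upperTail_of_massFlux hu hJ
  have hfatou : ∀ K : ℕ, ∑ k ∈ Finset.range K, u ^ (k + 1) ≤ m := fun K =>
    le_of_tendsto' (tendsto_finsetSum _ fun k _ => hS (k + 1)) fun n =>
      sum_le_hasSum _ (fun k _ => upperTail_nonneg (hP n) _) (hM n)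
  have hu1' : u < 1 := by
    refine lt_of_le_of_ne hu1 fun h => ?_
    obtain ⟨K, hK⟩ := exists_nat_gt m
    have := hfatou K
    simp only [h, one_pow, Finset.sum_const, Finset.card_range, nsmul_eq_mul, mul_one] at this
    linarith
  have hgeo : HasSum (fun k => u ^ (k + 1)) (u * (1 - u)⁻¹) := by
    simpa [pow_succ'] using (hasSum_geometric_of_lt_one hu0 hu1').mul_left u
  have hle : u * (1 - u)⁻¹ ≤ m := le_of_tendsto' hgeo.tendsto_sum_nat hfatou
  -- No mean is lost in the limit: for `ρ < 1` the excess converges to `m - ∑ min (u ^ k) (ρ ^ k)`,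
  -- `k ≥ 1`, and remains below its value at time 0, which tends to 0 as `ρ → 1`.
  have hge : m ≤ u * (1 - u)⁻¹ := by
    have key : ∀ n : ℕ, m - u * (1 - u)⁻¹ ≤ tailExcess (1 - 1 / ((n : ℝ) + 1)) q := by
      intro n
      have hn : (0 : ℝ) < 1 / ((n : ℝ) + 1) := by positivity
      have hρ0 : (0 : ℝ) ≤ 1 - 1 / ((n : ℝ) + 1) := by
        rw [sub_nonneg, div_le_one (by positivity)]
        linarith [(n.cast_nonneg : (0 : ℝ) ≤ n)]
      have h1 := le_of_tendsto' (tendsto_tailExcess_of_upperTail hP hM hS hρ0 (by linarith))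
        fun n => hx.tailExcess_antitoneOn hq hm hρ0 (by linarith) Set.self_mem_Ici (hτ n) (hτ n)
      simp only [hx.initial] at h1
      have h2 := Summable.tsum_le_tsum (f := fun k => min (u ^ (k + 1))
        ((1 - 1 / ((n : ℝ) + 1)) ^ (k + 1))) (fun k => min_le_left _ _)
        (Summable.of_nonneg_of_le (fun k => le_min (pow_nonneg hu0 _) (pow_nonneg hρ0 _))
          (fun k => min_le_left _ _) hgeo.summable) hgeo.summable
      rw [hgeo.tsum_eq] at h2
      linarith
    linarith [ge_of_tendsto' (tendsto_tailExcess_one hq hm) key]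
  have heq : u * (1 - u)⁻¹ = m := le_antisymm hle hge
  have hur : m / (1 + m) = u := by
    have h1u : 1 - u ≠ 0 := by linarith
    rw [← heq]; field_simp; ring
  rw [hur]
  have h := tendsto_tailExcess_of_upperTail hP hM hS hu0 hu1'
  simp only [min_self] at h
  rwa [hgeo.tsum_eq, heq, sub_self] at h

theorem tendsto_tailExcess (hx : IsFluidLimit q x) (hq : q ∈ probLaws) {m : ℝ}
    (hm : HasSum (fun k => upperTail q (k + 1)) m) :
    Filter.Tendsto (fun t => tailExcess (m / (1 + m)) (x t)) Filter.atTop (𝓝 0) := by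
  have hm0 : 0 ≤ m := hm.nonneg fun k => upperTail_nonneg hq _
  have hr0 : 0 ≤ m / (1 + m) := by positivity
  have hr1 : m / (1 + m) ≤ 1 := by rw [div_le_one (by positivity)]; linarith
  have hev : ∀ ε > 0, ∃ s, 0 ≤ s ∧ tailExcess (m / (1 + m)) (x s) < ε := by
    intro ε hε
    -- The entropy argument needs a positive mean; for `m = 0` the excess already vanishes at time
    -- 0.
    rcases hm0.eq_or_lt with h | h
    · refine ⟨0, le_rfl, lt_of_le_of_lt ?_ hε⟩
      rw [hx.initial]
      exact (tailExcess_le hq hm hr0).trans h.ge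
    · obtain ⟨τ, hτ, hlim⟩ := hx.exists_seq_tailExcess_tendsto hq hm h
      obtain ⟨n, hn⟩ := (hlim.eventually_lt_const hε).exists
      exact ⟨τ n, hτ n, hn⟩
  refine Metric.tendsto_atTop.2 fun ε hε => ?_
  obtain ⟨s, hs0, hs⟩ := hev ε hε
  refine ⟨s, fun t ht => ?_⟩
  rw [Real.dist_eq, sub_zero, abs_of_nonneg (tailExcess_nonneg _ _)]
  exact (hx.tailExcess_antitoneOn hq hm hr0 hr1 hs0 (Set.mem_Ici.2 (hs0.trans ht)) ht).trans_lt hs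

end IsFluidLimit

theorem proposition4 (q : EllOne) (hq : q ∈ probLaws)
    (lam : ℝ≥0) (hlam : HasSum (fun k : ℕ => (k : ℝ) * q k) (lam : ℝ))
    (x : ℝ → EllOne) (hx : IsFluidLimit q x) :
    Filter.Tendsto x Filter.atTop (𝓝 (geometricLaw lam)) := by
  have hm := hasSum_upperTail_of_hasSum_mean hq hlam
  rw [tendsto_iff_norm_sub_tendsto_zero]
  refine squeeze_zero' (Filter.Eventually.of_forall fun t => norm_nonneg _) ?_
    (by simpa using (hx.tendsto_tailExcess hq hm).const_mul 4)
  filter_upwards [Filter.eventually_ge_atTop 0] with t ht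
  exact norm_sub_geometricLaw_le (hx.mem_probLaws hq ht) (hx.hasSum_upperTail_mean hq hm ht) rfl
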